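/- Let $(\Omega,\mathcal F,\mathbb P)$ be a probability space, $L^0$ the ring of a.s.-equivalence classes of real-valued random variables with the order of almost sure dominance, $L^0_{++}=\{\varepsilon\in L^0:\varepsilon>0 \text{ a.s.}\}$, and $\bar L^0$ the set of classes of $[-\infty,\infty]$-valued random variables. Let $E$ be an $L^0$-module with an $L^0$-norm, that is, a map $\|\cdot\|:E\to L^0$ with $\|X\|\ge 0$, $\|YX\|=|Y|\,\|X\|$, $\|X_1+X_2\|\le\|X_1\|+\|X_2\|$ and $\|X\|=0\Rightarrow X=0$. A family $\mathcal P$ of $L^0$-seminorms induces the topology on $E$ in which the sets $\{Z: q(Z-X)\le\varepsilon \text{ for all } q\in Q\}$, with $Q\subset\mathcal P$ finite and $\varepsilon\in L^0_{++}$, form a neighbourhood base of $X$. The topologies of $E$ and of $L^0$ are those induced by $\|\cdot\|$ and by $|\cdot|$; $E^*$ is the set of continuous $L^0$-linear maps $\mu:E\to L^0$; and the weak topology $\sigma(E,E^*)$ is induced by the seminorms $X\mapsto|\mu(X)|$, $\mu\in E^*$. The topology of $\bar L^0$ has as neighbourhood base of $Y$ the sets, for $\varepsilon\in L^0_{++}$,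 of all $Z\in\bar L^0$ such that a.s. $|Z-Y|\le\varepsilon$ on $\{Y\in\mathbb R\}$, $Z\ge 1/\varepsilon$ on $\{Y=\infty\}$ and $Z\le-1/\varepsilon$ on $\{Y=-\infty\}$. A set $K\subset E$ has the relative countable concatenation property if $X\in K$ whenever $X\in E$ and there are a countable partition $(A_n)$ of $\Omega$ into (possibly empty) measurable sets and a sequence $(X_n)$ in $K$ with $1_{A_n}X=1_{A_n}X_n$ for all $n$. Suppose that the sum of $E$ preserves this property: if $L,M\subset E$ have it, then so does $L+M$. Let $f:E\to\bar L^0$ be proper, that is, $f(X)\in L^0$ for some $X\in E$ and, for every $X\in E$, $f(X)>-\infty$ a.s., and $L^0$-convex, that is, $f(YX_1+(1-Y)X_2)\le Yf(X_1)+(1-Y)f(X_2)$ for all $X_1,X_2\in E$ and $Y\in L^0$ with $0\le Y\le1$ (where $0\cdot\infty=0$). If $f$ is continuous from $E$, with the topology induced by $\|\cdot\|$, to $\bar L^0$, then $f$ is lower semicontinuous for the weak topology: for every $Y_0\in L^0$ the level set $\{X\in E: f(X)\le Y_0\}$ is closed for $\sigma(E,E^*)$. -/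

import Mathlib

open MeasureTheory
open scoped Pointwise Topology

noncomputable section

namespace L0Convex

/-- `L⁰(Ω, ℱ, P)`: a.s.-equivalence classes of real random variables, with its ring structure and
the order of almost sure dominance (`Y ≤ Z` means `P(Y ≤ Z) = 1`). -/
abbrev L0 {Ω : Type*} [MeasurableSpace Ω] (P : Measure Ω) := Ω →ₘ[P] ℝ

/-- The a.s.-equivalence classes of random variables with values in `[-∞, ∞]`, with the order of
almost sure dominance. -/
abbrev L0bar {Ω : Type*} [MeasurableSpace Ω] (P : Measure Ω) := Ω →ₘ[P] EReal

variable {Ω : Type*} [MeasurableSpace Ω] {P : Measure Ω}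

/-- The ring structure of `L⁰`, on Mathlib's a.s.-pointwise addition and multiplication. -/
instance instCommRingL0 (P : Measure Ω) : CommRing (L0 P) where
  __ := (inferInstance : AddCommGroup (Ω →ₘ[P] ℝ))
  __ := (inferInstance : CommMonoid (Ω →ₘ[P] ℝ))
  left_distrib a b c := by
    refine AEEqFun.induction_on₃ a b c fun f _ g _ h _ => ?_
    simp only [AEEqFun.mk_add_mk, AEEqFun.mk_mul_mk, mul_add]
  right_distrib a b c := by
    refine AEEqFun.induction_on₃ a b c fun f _ g _ h _ => ?_
    simp only [AEEqFun.mk_add_mk, AEEqFun.mk_mul_mk, add_mul]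
  zero_mul a := by
    refine AEEqFun.induction_on a fun f _ => ?_
    exact (AEEqFun.mk_mul_mk _ _ _ _).trans (by simp only [AEEqFun.zero_def, zero_mul, Pi.mul_def])
  mul_zero a := by
    refine AEEqFun.induction_on a fun f _ => ?_
    exact (AEEqFun.mk_mul_mk _ _ _ _).trans (by simp only [AEEqFun.zero_def, mul_zero, Pi.mul_def])

/-- The inclusion of `L⁰` into its extended version. -/
def toBar (Y : L0 P) : L0bar P :=
  AEEqFun.comp Real.toEReal continuous_coe_real_ereal Y

/-- `L⁰₊₊`: the a.s. strictly positive elements. -/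
def L0pp (P : Measure Ω) : Set (L0 P) := {ε | ∀ᵐ ω ∂P, 0 < ε ω}

/-- The class of the indicator function of a measurable set. -/
def ind (P : Measure Ω) (A : Set Ω) (hA : MeasurableSet A) : L0 P :=
  AEEqFun.mk (A.indicator fun _ => (1 : ℝ))
    (stronglyMeasurable_const.indicator hA).aestronglyMeasurable

theorem inf_mem_L0pp {ε δ : L0 P} (hε : ε ∈ L0pp P) (hδ : δ ∈ L0pp P) : ε ⊓ δ ∈ L0pp P := by
  filter_upwards [hε, hδ, AEEqFun.coeFn_inf ε δ] with ω h1 h2 h3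
  rw [h3]
  exact lt_min h1 h2

theorem one_mem_L0pp : (1 : L0 P) ∈ L0pp P := by
  filter_upwards [AEEqFun.coeFn_one (α := Ω) (β := ℝ) (μ := P)] with ω h
  rw [h]
  exact one_pos

section Modules

variable {E : Type*} [AddCommGroup E] [Module (L0 P) E]

/-- `X` is a countable concatenation of `(Xₙ)` along the measurable sets `(Aₙ)`:
`1_{Aₙ} Xₙ = 1_{Aₙ} X` for all `n`. -/
def IsConcatenation (A : ℕ → Set Ω) (hA : ∀ n, MeasurableSet (A n)) (x : ℕ → E) (X : E) : Prop :=
  ∀ n, ind P (A n) (hA n) • x n = ind P (A n) (hA n) • X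

/-- The relative countable concatenation property of a subset `K` of an `L⁰`-module: any countable
concatenation, along a countable measurable partition of `Ω`, of a sequence in `K` that exists in
the module lies in `K`. -/
def HasRelCCP (P : Measure Ω) [Module (L0 P) E] (K : Set E) : Prop :=
  ∀ (A : ℕ → Set Ω) (hA : ∀ n, MeasurableSet (A n)),
    (⋃ n, A n) = Set.univ → (∀ i j, i ≠ j → A i ∩ A j = ∅) →
    ∀ x : ℕ → E, (∀ n, x n ∈ K) → ∀ X : E, IsConcatenation (P := P) A hA x X → X ∈ K

/-- The sum of `E` preserves the relative countable concatenation property. -/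
def SumPreservesRelCCP (P : Measure Ω) (E : Type*) [AddCommGroup E] [Module (L0 P) E] : Prop :=
  ∀ L M : Set E, HasRelCCP P L → HasRelCCP P M → HasRelCCP P (L + M)

/-- `L⁰`-norms on an `L⁰`-module. -/
structure IsL0Norm (N : E → L0 P) : Prop where
  nonneg : ∀ X, 0 ≤ N X
  smul : ∀ (Y : L0 P) (X : E), N (Y • X) = |Y| * N X
  add_le : ∀ X₁ X₂, N (X₁ + X₂) ≤ N X₁ + N X₂
  eq_zero : ∀ X, N X = 0 → X = 0

/-- The topology induced by a family `S` of `L⁰`-seminorms: the sets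
`X + {Z | q Z ≤ ε for all q ∈ Q}`, with `Q ⊆ S` finite and `ε ∈ L⁰₊₊`, are a neighbourhood
base of `X`. -/
def seminormTopology (S : Set (E → L0 P)) : TopologicalSpace E where
  IsOpen U := ∀ X ∈ U, ∃ Q : Set (E → L0 P), Q.Finite ∧ Q ⊆ S ∧ ∃ ε ∈ L0pp P,
    ∀ Z, (∀ q ∈ Q, q (Z - X) ≤ ε) → Z ∈ U
  isOpen_univ := fun _ _ =>
    ⟨∅, Set.finite_empty, Set.empty_subset _, 1, one_mem_L0pp, fun _ _ => Set.mem_univ _⟩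
  isOpen_inter := by
    rintro U V hU hV X ⟨hXU, hXV⟩
    obtain ⟨Q, hQ, hQS, ε, hε, h⟩ := hU X hXU
    obtain ⟨R, hR, hRS, δ, hδ, h'⟩ := hV X hXV
    refine ⟨Q ∪ R, hQ.union hR, Set.union_subset hQS hRS, ε ⊓ δ, inf_mem_L0pp hε hδ,
      fun Z hZ => ⟨h Z fun q hq => ?_, h' Z fun q hq => ?_⟩⟩
    · exact (hZ q (Or.inl hq)).trans inf_le_left
    · exact (hZ q (Or.inr hq)).trans inf_le_right
  isOpen_sUnion := by
    rintro F hF X ⟨U, hU, hXU⟩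
    obtain ⟨Q, hQ, hQS, ε, hε, h⟩ := hF U hU X hXU
    exact ⟨Q, hQ, hQS, ε, hε, fun Z hZ => ⟨U, hU, h Z hZ⟩⟩

/-- The topology of an `L⁰`-normed module. -/
def normTopology (N : E → L0 P) : TopologicalSpace E := seminormTopology {N}

/-- The topology of `L⁰`, with the neighbourhoods `Y + {Z | |Z| ≤ ε}`, `ε ∈ L⁰₊₊`. -/
def L0topology (P : Measure Ω) : TopologicalSpace (L0 P) := normTopology fun Y : L0 P => |Y|

/-- The weak topology `σ(E, E*)` of an `L⁰`-normed module: it is induced by the seminorms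
`X ↦ |μ X|`, where `μ` ranges over the continuous `L⁰`-linear functions `E → L⁰`. -/
def weakTopology (N : E → L0 P) : TopologicalSpace E :=
  seminormTopology {q | ∃ μ : E →ₗ[L0 P] L0 P,
    Continuous[normTopology N, L0topology P] μ ∧ q = fun X => |μ X|}

end Modules

/-- `z ∈ [-∞, ∞]` lies in the neighbourhood of size `e > 0` of `y`: this is `[y - e, y + e]`
for real `y`, `[1/e, ∞]` for `y = ∞` and `[-∞, -1/e]` for `y = -∞`. -/
def Near (e : ℝ) (y z : EReal) : Prop :=
  (y = ⊤ → ((1 / e : ℝ) : EReal) ≤ z) ∧ (y = ⊥ → z ≤ ((-(1 / e) : ℝ) : EReal)) ∧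
    ∀ r : ℝ, y = (r : EReal) → ((r - e : ℝ) : EReal) ≤ z ∧ z ≤ ((r + e : ℝ) : EReal)

theorem Near.mono {d e : ℝ} (hd : 0 < d) (hde : d ≤ e) {y z : EReal} (h : Near d y z) :
    Near e y z := by
  have h1 : 1 / e ≤ 1 / d := one_div_le_one_div_of_le hd hde
  refine ⟨fun hy => le_trans ?_ (h.1 hy), fun hy => (h.2.1 hy).trans ?_, fun r hr =>
    ⟨le_trans ?_ (h.2.2 r hr).1, (h.2.2 r hr).2.trans ?_⟩⟩ <;>
  · rw [EReal.coe_le_coe_iff]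
    linarith

/-- The topology of the extended `L⁰`: the sets of all `Z` which a.s. lie in the neighbourhood of
(random) size `ε ∈ L⁰₊₊` of `Y` are a neighbourhood base of `Y`. It restricts to the topology of
`L⁰`, and is the usual topology of `[-∞, ∞]` if `ℱ` is trivial. -/
def L0barTopology (P : Measure Ω) : TopologicalSpace (L0bar P) where
  IsOpen U := ∀ Y ∈ U, ∃ ε ∈ L0pp P, ∀ Z : L0bar P, (∀ᵐ ω ∂P, Near (ε ω) (Y ω) (Z ω)) → Z ∈ U
  isOpen_univ := fun _ _ => ⟨1, one_mem_L0pp, fun _ _ => Set.mem_univ _⟩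
  isOpen_inter := by
    rintro U V hU hV Y ⟨hYU, hYV⟩
    obtain ⟨ε, hε, h⟩ := hU Y hYU
    obtain ⟨δ, hδ, h'⟩ := hV Y hYV
    refine ⟨ε ⊓ δ, inf_mem_L0pp hε hδ, fun Z hZ => ⟨h Z ?_, h' Z ?_⟩⟩ <;>
    · filter_upwards [hZ, hε, hδ, AEEqFun.coeFn_inf ε δ] with ω h1 h2 h3 h4
      rw [h4] at h1
      first
        | exact h1.mono (lt_min h2 h3) (min_le_left _ _)
        | exact h1.mono (lt_min h2 h3) (min_le_right _ _)
  isOpen_sUnion := by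
    rintro F hF Y ⟨U, hU, hYU⟩
    obtain ⟨ε, hε, h⟩ := hF U hU Y hYU
    exact ⟨ε, hε, fun Z hZ => ⟨U, hU, h Z hZ⟩⟩

section Functions

variable {E : Type*}

/-- `f` is proper: it takes some value in `L⁰`, and `f > -∞` (a.s., everywhere on `E`). -/
def IsProper (f : E → L0bar P) : Prop :=
  (∃ (X : E) (Y : L0 P), f X = toBar Y) ∧ ∀ X, ∀ᵐ ω ∂P, ⊥ < f X ω

/-- `L⁰`-convex functions: `f (Y X₁ + (1 - Y) X₂) ≤ Y f(X₁) + (1 - Y) f(X₂)` a.s. whenever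
`0 ≤ Y ≤ 1`, with the convention `0 · ∞ = 0` (which is that of `EReal`). -/
def IsL0Convex [AddCommGroup E] [Module (L0 P) E] (f : E → L0bar P) : Prop :=
  ∀ (X₁ X₂ : E) (Y : L0 P), 0 ≤ Y → Y ≤ 1 →
    ∀ᵐ ω ∂P, f (Y • X₁ + (1 - Y) • X₂) ω ≤
      ((Y ω : ℝ) : EReal) * f X₁ ω + ((1 - Y ω : ℝ) : EReal) * f X₂ ω

/-- `f` is lower semicontinuous for `τ`: the level sets `{X | f X ≤ Y₀}`, `Y₀ ∈ L⁰`, are closed. -/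
def IsLowerSemicont (τ : TopologicalSpace E) (f : E → L0bar P) : Prop :=
  ∀ Y₀ : L0 P, IsClosed[τ] {X | f X ≤ toBar Y₀}

end Functions

end L0Convex

end

/-! Let `C = {f ≤ Y₀}`, `X₀ ∉ C` and `B = {f X₀ > Y₀}`. By continuity, `f > Y₀` on `B` throughout a
norm ball of random radius `ε` about `X₀`. Convexity allows pasting along events, which turns this
into a local statement: every `Z ∈ C` satisfies `N (Z - X₀) > ε` almost everywhere on `B`
(`lt_norm_of_level`). Since `X₀ - C` is convex, a Hahn-Banach argument over `L⁰` gives a linear `μ ≤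
N`, hence continuous, with `μ (X₀ - Z) ≥ 1_B ε` on `C` (`exists_linearMap_le_of_convex`). A point of
`C` with `|μ (Z - X₀)| ≤ ε / 2` would force `B` to be null, so this weak neighbourhood of `X₀`
misses `C`. The Hahn-Banach part uses only that `L⁰` has essential infima and that `0 ≤ a ≤ t` makes
`a` a multiple of `t`. -/

namespace L0Convex

/-! ### Order and division in `L⁰`; essential infima. -/

section RandomVariables

variable {Ω : Type*} [MeasurableSpace Ω] {P : Measure Ω}

instance instIsOrderedAddMonoidL0 : IsOrderedAddMonoid (L0 P) where
  add_le_add_left a b h c := by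
    rw [← AEEqFun.coeFn_le] at h ⊢
    filter_upwards [h, AEEqFun.coeFn_add a c, AEEqFun.coeFn_add b c] with ω h h1 h2
    rw [h1, h2]
    exact add_le_add_left h _

instance instIsOrderedRingL0 : IsOrderedRing (L0 P) :=
  have : ZeroLEOneClass (L0 P) := ⟨by
    rw [← AEEqFun.coeFn_le]
    filter_upwards [AEEqFun.coeFn_zero (α := Ω) (β := ℝ) (μ := P),
      AEEqFun.coeFn_one (α := Ω) (β := ℝ) (μ := P)] with ω h0 h1
    rw [h0, h1]
    exact zero_le_one⟩
  IsOrderedRing.of_mul_nonneg fun a b ha hb => by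
    rw [← AEEqFun.coeFn_le] at ha hb ⊢
    filter_upwards [ha, hb, AEEqFun.coeFn_zero (α := Ω) (β := ℝ) (μ := P),
      AEEqFun.coeFn_mul a b] with ω ha hb h0 h
    rw [h0] at ha hb ⊢
    rw [h]
    exact mul_nonneg ha hb

/-- In `L⁰`, every `a` with `0 ≤ a ≤ t` is a multiple of `t` by some `Y` with `0 ≤ Y ≤ 1`. -/
theorem exists_mul_eq_of_le {a t : L0 P} (ha : 0 ≤ a) (hat : a ≤ t) :
    ∃ Y : L0 P, 0 ≤ Y ∧ Y ≤ 1 ∧ t * Y = a := by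
  have h := AEEqFun.coeFn_comp₂Measurable (fun x y : ℝ => x / y) measurable_div a t
  set Y : L0 P := AEEqFun.comp₂Measurable (fun x y : ℝ => x / y) measurable_div a t
  have h0 := AEEqFun.coeFn_zero (α := Ω) (β := ℝ) (μ := P)
  rw [← AEEqFun.coeFn_le] at ha hat
  refine ⟨Y, ?_, ?_, ?_⟩
  · rw [← AEEqFun.coeFn_le]
    filter_upwards [h, h0, ha, hat] with ω h h0 ha hat
    rw [h0] at ha ⊢
    rw [h]
    exact div_nonneg ha (ha.trans hat)
  · rw [← AEEqFun.coeFn_le]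
    filter_upwards [h, h0, ha, hat, AEEqFun.coeFn_one (α := Ω) (β := ℝ) (μ := P)]
      with ω h h0 ha hat h1
    rw [h0] at ha
    rw [h, h1]
    exact div_le_one_of_le₀ hat (ha.trans hat)
  · refine AEEqFun.ext ?_
    filter_upwards [h, h0, ha, hat, AEEqFun.coeFn_mul t Y] with ω h h0 ha hat hm
    rw [h0] at ha
    rw [hm, Pi.mul_apply, h]
    -- Where `t = 0` the quotient has the default value 0, which is harmless because `a` vanishes
    -- there too.
    refine mul_div_cancel_of_imp' fun ht => ?_
    rw [ht] at hat
    exact le_antisymm hat ha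

/-- A sequence of random variables which is bounded below has an infimum. -/
theorem exists_isGLB_range {s : ℕ → L0 P} {b : L0 P} (hb : ∀ n, b ≤ s n) :
    ∃ g, IsGLB (Set.range s) g := by
  have hm : AEMeasurable (fun ω => ⨅ n, s n ω) P := AEMeasurable.iInf fun n => (s n).aemeasurable
  have hg := AEEqFun.coeFn_mk _ hm.aestronglyMeasurable
  -- Real infima are meaningful only for families bounded below, which `b` guarantees almost
  -- everywhere.
  have hb' : ∀ᵐ ω ∂P, ∀ n, b ω ≤ s n ω := ae_all_iff.2 fun n => AEEqFun.coeFn_le.2 (hb n)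
  refine ⟨AEEqFun.mk _ hm.aestronglyMeasurable, ?_, ?_⟩
  · rintro _ ⟨n, rfl⟩
    rw [← AEEqFun.coeFn_le]
    filter_upwards [hg, hb'] with ω hg hb
    rw [hg]
    exact ciInf_le ⟨b ω, by rintro _ ⟨n, rfl⟩; exact hb n⟩ n
  · intro c hc
    have hc' : ∀ᵐ ω ∂P, ∀ n, c ω ≤ s n ω :=
      ae_all_iff.2 fun n => AEEqFun.coeFn_le.2 (hc ⟨n, rfl⟩)
    rw [← AEEqFun.coeFn_le]
    filter_upwards [hg, hc'] with ω hg hc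
    rw [hg]
    exact le_ciInf hc

theorem integrable_arctan [IsFiniteMeasure P] (Y : L0 P) :
    Integrable (fun ω => Real.arctan (Y ω)) P :=
  Integrable.of_bound (Real.continuous_arctan.comp_aestronglyMeasurable Y.aestronglyMeasurable)
    (Real.pi / 2) (Filter.Eventually.of_forall fun ω => by
      rw [Real.norm_eq_abs, abs_le]
      exact ⟨(Real.neg_pi_div_two_lt_arctan _).le, (Real.arctan_lt_pi_div_two _).le⟩)

theorem integral_arctan_mono [IsFiniteMeasure P] {Y Z : L0 P} (h : Y ≤ Z) :
    ∫ ω, Real.arctan (Y ω) ∂P ≤ ∫ ω, Real.arctan (Z ω) ∂P := by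
  refine integral_mono_ae (integrable_arctan Y) (integrable_arctan Z) ?_
  filter_upwards [AEEqFun.coeFn_le.2 h] with ω h
  exact Real.arctan_mono h

/-- The function arctan is bounded and strictly increasing, so its integral is a finite functional
that detects strict inequality on a non-null event. -/
theorem eq_of_le_of_integral_arctan_le [IsFiniteMeasure P] {Y Z : L0 P} (h : Y ≤ Z)
    (h' : ∫ ω, Real.arctan (Z ω) ∂P ≤ ∫ ω, Real.arctan (Y ω) ∂P) : Y = Z := by
  have hle : (fun ω => Real.arctan (Y ω)) ≤ᵐ[P] fun ω => Real.arctan (Z ω) := by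
    filter_upwards [AEEqFun.coeFn_le.2 h] with ω h
    exact Real.arctan_mono h
  have := (integral_eq_iff_of_ae_le (integrable_arctan Y) (integrable_arctan Z) hle).1
    (le_antisymm (integral_arctan_mono h) h')
  refine AEEqFun.ext ?_
  filter_upwards [this] with ω h
  exact Real.arctan_injective h

/-- The essential infimum: `L⁰` is Dedekind complete. -/
theorem exists_isGLB [IsFiniteMeasure P] {S : Set (L0 P)} (hS : S.Nonempty) (hb : BddBelow S) :
    ∃ g, IsGLB S g := by
  obtain ⟨b, hb⟩ := hb
  -- Infima of countable subfamilies always exist; the one minimising `I` will be the infimum of all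
  -- of `S`.
  set T : Set (L0 P) := {g | ∃ s : ℕ → L0 P, (∀ n, s n ∈ S) ∧ IsGLB (Set.range s) g}
  set I : L0 P → ℝ := fun Y => ∫ ω, Real.arctan (Y ω) ∂P
  have hT : ∀ s : ℕ → L0 P, (∀ n, s n ∈ S) → ∃ g ∈ T, IsGLB (Set.range s) g := fun s hs => by
    obtain ⟨g, hg⟩ := exists_isGLB_range fun n => hb (hs n)
    exact ⟨g, ⟨s, hs, hg⟩, hg⟩
  have hbT : ∀ g ∈ T, b ≤ g := by
    rintro g ⟨s, hs, hg⟩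
    exact hg.2 (by rintro _ ⟨n, rfl⟩; exact hb (hs n))
  have hbdd : BddBelow (I '' T) := ⟨I b, by
    rintro _ ⟨g, hg, rfl⟩
    exact integral_arctan_mono (hbT g hg)⟩
  have hne : (I '' T).Nonempty := by
    obtain ⟨Y, hY⟩ := hS
    obtain ⟨g, hg, -⟩ := hT (fun _ => Y) fun _ => hY
    exact ⟨_, g, hg, rfl⟩
  have happrox : ∀ k : ℕ, ∃ g ∈ T, I g < sInf (I '' T) + 1 / ((k : ℝ) + 1) := fun k => by
    obtain ⟨_, ⟨g, hg, rfl⟩, h⟩ := exists_lt_of_csInf_lt hne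
      (lt_add_of_pos_right (sInf (I '' T)) (Nat.one_div_pos_of_nat (α := ℝ) (n := k)))
    exact ⟨g, hg, h⟩
  choose γ hγT hγ using happrox
  choose s hs hγs using hγT
  -- Pairing merges countably many sequences into one, so the minimum of `I` is attained within `T`.
  obtain ⟨g, hgT, hg⟩ := hT (fun n => s n.unpair.1 n.unpair.2) fun n => hs _ _
  have hgγ : ∀ k, g ≤ γ k := fun k => (hγs k).2 (by
    rintro _ ⟨n, rfl⟩
    have := hg.1 ⟨Nat.pair k n, rfl⟩
    simpa only [Nat.unpair_pair] using this)
  have hIg : I g ≤ sInf (I '' T) := by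
    refine le_of_forall_pos_lt_add fun e he => ?_
    obtain ⟨k, hk⟩ := exists_nat_one_div_lt he
    exact ((integral_arctan_mono (hgγ k)).trans_lt (hγ k)).trans (by linarith)
  obtain ⟨σ, hσ, hgσ⟩ := hgT
  refine ⟨g, fun Y hY => ?_, fun c hc => hgσ.2 (by rintro _ ⟨n, rfl⟩; exact hc (hσ n))⟩
  -- Adjoining `Y` to the sequence cannot lower `I` below its minimum, so it does not change the
  -- infimum.
  obtain ⟨h, hhT, hh⟩ := hT (fun n => Nat.casesOn n Y σ) fun n => by cases n; exacts [hY, hσ _]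
  have hhg : h ≤ g := hgσ.2 (by rintro _ ⟨n, rfl⟩; exact hh.1 ⟨n + 1, rfl⟩)
  have hhY : h ≤ Y := hh.1 ⟨0, rfl⟩
  rwa [eq_of_le_of_integral_arctan_le hhg (hIg.trans (csInf_le hbdd ⟨h, hhT, rfl⟩))] at hhY

end RandomVariables

end L0Convex

namespace L0Convex

/-! ### Hahn-Banach and separation over a complete ordered ring. -/

section HahnBanach

/-- `L⁰`-sublinear functions. -/
structure IsSublinear {R E : Type*} [CommRing R] [Lattice R] [AddCommGroup E] [Module R E]
    (q : E → R) : Prop where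
  add_le : ∀ x y, q (x + y) ≤ q x + q y
  smul_le : ∀ (a : R) (x : E), 0 ≤ a → q (a • x) ≤ a * q x

variable {R E : Type*} [CommRing R] [Lattice R] [IsOrderedRing R]
  [AddCommGroup E] [Module R E]

namespace IsSublinear

variable {q : E → R}

theorem zero (hq : IsSublinear q) : q 0 = 0 := by
  refine le_antisymm ?_ ?_
  · simpa using hq.smul_le 0 0 le_rfl
  · have := hq.add_le 0 0
    rw [add_zero] at this
    exact le_add_iff_nonneg_left _ |>.1 this

theorem neg_le (hq : IsSublinear q) (x : E) : -q (-x) ≤ q x := by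
  have := hq.add_le x (-x)
  rw [add_neg_cancel, hq.zero] at this
  exact neg_le_iff_add_nonneg.2 this

end IsSublinear

/-- The properties of the ordered ring `L⁰` on which the Hahn-Banach theorem relies. -/
class IsCompleteDivOrdered (R : Type*) [CommRing R] [Lattice R] : Prop where
  exists_isGLB : ∀ {S : Set R}, S.Nonempty → BddBelow S → ∃ g, IsGLB S g
  exists_mul_eq : ∀ {a t : R}, 0 ≤ a → a ≤ t → ∃ y, 0 ≤ y ∧ y ≤ 1 ∧ t * y = a

variable [IsCompleteDivOrdered R]

/-- A non-negative `a` may be a zero divisor; the unit `1 + a` replaces it wherever a division is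
needed. -/
theorem exists_inv_one_add {a : R} (ha : 0 ≤ a) : ∃ u, 0 ≤ u ∧ u ≤ 1 ∧ (1 + a) * u = 1 :=
  IsCompleteDivOrdered.exists_mul_eq zero_le_one (le_add_of_nonneg_right ha)

/-- Multiplication by a non-negative element preserves infima. -/
theorem le_mul_of_isGLB {S : Set R} {g a z : R} (hg : IsGLB S g) (ha : 0 ≤ a)
    (h : ∀ s ∈ S, z ≤ a * s) : z ≤ a * g := by
  obtain ⟨u, hu, -, hu1⟩ := exists_inv_one_add ha
  -- The left side is again a lower bound of `S`, because `z - a * g ≤ a * (s - g) ≤ (1 + a) * (s -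
  -- g)` and `u` inverts `1 + a`.
  have key : g + u * (z - a * g) ≤ g := hg.2 fun s hs => by
    have h1 : z - a * g ≤ (1 + a) * (s - g) := by
      linear_combination h s hs + hg.1 hs
    have h2 := mul_le_mul_of_nonneg_left h1 hu
    have h3 : u * ((1 + a) * (s - g)) = s - g := by linear_combination (s - g) * hu1
    linear_combination h2 + h3
  have h4 : u * (z - a * g) ≤ 0 := by linear_combination key
  have h5 := mul_le_mul_of_nonneg_left h4 (add_nonneg zero_le_one ha)
  have h6 : (1 + a) * (u * (z - a * g)) = z - a * g := by linear_combination (z - a * g) * hu1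
  rw [h6, mul_zero] at h5
  exact sub_nonpos.1 h5

namespace IsSublinear

variable {q : E → R}

theorem smul_eq (hq : IsSublinear q) {a : R} (ha : 0 ≤ a) (x : E) : q (a • x) = a * q x := by
  refine le_antisymm (hq.smul_le a x ha) ?_
  -- For `b ≤ 1` subadditivity applies to `x = b • x + (1 - b) • x`; a general `a` is rescaled to `u
  -- * a ≤ 1`.
  have key : ∀ b : R, 0 ≤ b → b ≤ 1 → b * q x ≤ q (b • x) := fun b _ hb1 => by
    have h1 := hq.add_le (b • x) ((1 - b) • x)
    rw [← add_smul, add_sub_cancel, one_smul] at h1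
    have h2 := hq.smul_le (1 - b) x (sub_nonneg.2 hb1)
    linear_combination h1 + h2
  obtain ⟨u, hu, -, hu1⟩ := exists_inv_one_add ha
  have hua : u * a ≤ 1 := by linear_combination hu + hu1
  have h1 := (key (u * a) (mul_nonneg hu ha) hua).trans (mul_smul u a x ▸ hq.smul_le u (a • x) hu)
  have h2 := mul_le_mul_of_nonneg_left h1 (add_nonneg zero_le_one ha)
  calc a * q x = (1 + a) * (u * a * q x) := by linear_combination (-a * q x) * hu1
    _ ≤ (1 + a) * (u * q (a • x)) := h2
    _ = q (a • x) := by linear_combination q (a • x) * hu1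

/-- A sublinear function which dominates the second coordinate on a convex cone `G` of pairs can
be decreased so as to satisfy `p (-V) ≤ -s` for all `(V, s)` in `G`. -/
theorem exists_le_of_cone (hq : IsSublinear q) {G : Set (E × R)} (h0 : (0, 0) ∈ G)
    (hadd : ∀ v ∈ G, ∀ w ∈ G, v + w ∈ G) (hsmul : ∀ a : R, 0 ≤ a → ∀ v ∈ G, a • v ∈ G)
    (hG : ∀ v ∈ G, v.2 ≤ q v.1) :
    ∃ p : E → R, IsSublinear p ∧ p ≤ q ∧ ∀ v ∈ G, p (-v.1) ≤ -v.2 := by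
  -- The new function is `p x = inf {q (x + V) - s}` over `(V, s) ∈ G`. The cone element `(0, 0)`
  -- yields `p ≤ q`, and evaluating at `-V` yields the extra bound.
  have hglb : ∀ x, ∃ g, IsGLB ((fun v : E × R => q (x + v.1) - v.2) '' G) g := fun x => by
    refine IsCompleteDivOrdered.exists_isGLB ⟨_, _, h0, rfl⟩ ⟨-q (-x), ?_⟩
    rintro _ ⟨v, hv, rfl⟩
    have h1 := hG v hv
    have h2 := hq.add_le (-x) (x + v.1)
    rw [neg_add_cancel_left] at h2
    linear_combination h1 + h2
  choose p hp using hglb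
  have hle : ∀ x, ∀ v ∈ G, p x ≤ q (x + v.1) - v.2 := fun x v hv => (hp x).1 ⟨v, hv, rfl⟩
  refine ⟨p, ⟨fun x y => ?_, fun a x ha => ?_⟩, fun x => ?_, fun v hv => ?_⟩
  · have h1 : p (x + y) - p y ≤ p x := (hp x).2 (by
      rintro _ ⟨v, hv, rfl⟩
      rw [sub_le_comm]
      refine (hp y).2 ?_
      rintro _ ⟨w, hw, rfl⟩
      have h2 := hle (x + y) _ (hadd v hv w hw)
      have h3 := hq.add_le (x + v.1) (y + w.1)
      rw [add_add_add_comm] at h3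
      simp only [Prod.fst_add, Prod.snd_add] at h2
      linear_combination h2 + h3)
    exact sub_le_iff_le_add.1 h1
  · refine le_mul_of_isGLB (hp x) ha ?_
    rintro _ ⟨v, hv, rfl⟩
    have h2 := hle (a • x) _ (hsmul a ha v hv)
    have h3 := hq.smul_le a (x + v.1) ha
    rw [smul_add] at h3
    simp only [Prod.smul_fst, Prod.smul_snd, smul_eq_mul] at h2
    linear_combination h2 + h3
  · simpa using hle x _ h0
  · simpa [hq.zero] using hle (-v.1) v hv

/-- A minimal sublinear function is odd. -/
theorem neg_eq_of_minimal (hq : IsSublinear q) (hmin : ∀ p : E → R, IsSublinear p → p ≤ q → q ≤ p)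
    (x : E) : q (-x) = -q x := by
  -- The cone spanned by `(x, q x)` gives `p (-x) ≤ -q x`, and minimality carries this bound over to
  -- `q`.
  obtain ⟨p, hp, hpq, h⟩ := hq.exists_le_of_cone (G := {v | ∃ t : R, 0 ≤ t ∧ v = (t • x, t * q x)})
    ⟨0, le_rfl, by simp⟩
    (by
      rintro _ ⟨s, hs, rfl⟩ _ ⟨t, ht, rfl⟩
      exact ⟨s + t, add_nonneg hs ht, by simp [add_smul, add_mul]⟩)
    (by
      rintro a ha _ ⟨t, ht, rfl⟩
      exact ⟨a * t, mul_nonneg ha ht, by simp [mul_smul, mul_assoc]⟩)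
    (by
      rintro _ ⟨t, ht, rfl⟩
      exact (hq.smul_eq ht x).ge)
  have h1 := h (x, q x) ⟨1, zero_le_one, by simp⟩
  refine le_antisymm ((hmin p hp hpq _).trans h1) ?_
  have := hq.neg_le x
  exact _root_.neg_le.1 this

/-- Zorn's lemma in the dual order: pointwise infima of chains stay sublinear, since of two members
of a chain the smaller serves for both arguments. -/
theorem exists_minimal_le (hq : IsSublinear q) :
    ∃ m : E → R, IsSublinear m ∧ m ≤ q ∧ ∀ p : E → R, IsSublinear p → p ≤ m → m ≤ p := by
  obtain ⟨m, hmq, hm⟩ := @zorn_le_nonempty₀ (E → R)ᵒᵈ _ {p | IsSublinear (E := E) (R := R) p} (by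
    intro c hc hchain p₀ hp₀
    have hchain' : ∀ p ∈ c, ∀ r ∈ c, (∀ x, (p : E → R) x ≤ (r : E → R) x) ∨
        ∀ x, (r : E → R) x ≤ (p : E → R) x := fun p hp r hr =>
      (hchain.total hp hr).symm
    have hglb : ∀ x, ∃ g, IsGLB ((fun p : E → R => p x) '' c) g := fun x => by
      refine IsCompleteDivOrdered.exists_isGLB ⟨_, p₀, hp₀, rfl⟩ ⟨-(p₀ : E → R) (-x), ?_⟩
      rintro _ ⟨p, hp, rfl⟩
      rcases hchain' p hp p₀ hp₀ with h | h
      · exact (neg_le_neg (h (-x))).trans ((hc hp).neg_le x)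
      · exact ((hc hp₀).neg_le x).trans (h x)
    choose g hg using hglb
    have hle : ∀ x, ∀ p ∈ c, g x ≤ (p : E → R) x := fun x p hp => (hg x).1 ⟨p, hp, rfl⟩
    refine ⟨g, ⟨fun x y => ?_, fun a x ha => ?_⟩, fun p hp x => hle x p hp⟩
    · have h1 : g (x + y) - g y ≤ g x := (hg x).2 (by
        rintro _ ⟨p, hp, rfl⟩
        rw [sub_le_comm]
        refine (hg y).2 ?_
        rintro _ ⟨r, hr, rfl⟩
        rcases hchain' p hp r hr with h | h
        · have h2 := (hle (x + y) p hp).trans ((hc hp).add_le x y)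
          linear_combination h2 + h y
        · have h2 := (hle (x + y) r hr).trans ((hc hr).add_le x y)
          linear_combination h2 + h x)
      exact sub_le_iff_le_add.1 h1
    · refine le_mul_of_isGLB (hg x) ha ?_
      rintro _ ⟨p, hp, rfl⟩
      exact (hle _ p hp).trans ((hc hp).smul_le a x ha)) q hq
  exact ⟨m, hm.1, hmq, fun p hp hpm => hm.2 hp hpm⟩

/-- The Hahn-Banach theorem: a sublinear function dominates a linear one. -/
theorem exists_linearMap_le (hq : IsSublinear q) : ∃ μ : E →ₗ[R] R, ∀ x, μ x ≤ q x := by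
  obtain ⟨m, hm, hmq, hmin⟩ := hq.exists_minimal_le
  have hneg := hm.neg_eq_of_minimal hmin
  have hadd : ∀ x y, m (x + y) = m x + m y := fun x y => by
    refine le_antisymm (hm.add_le x y) ?_
    have := hm.add_le (-x) (-y)
    rw [← neg_add, hneg, hneg, hneg, ← neg_add] at this
    exact neg_le_neg_iff.1 this
  have hsmul : ∀ (a : R) (x : E), m (a • x) = a * m x := fun a x => by
    rw [← posPart_sub_negPart a, sub_smul, sub_eq_add_neg, hadd, hneg,
      hm.smul_eq (posPart_nonneg a), hm.smul_eq (negPart_nonneg a)]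
    ring
  exact ⟨{ toFun := m, map_add' := hadd, map_smul' := hsmul }, hmq⟩

/-- Separation of a convex set from the origin: if `q` is bounded below by `e` on a nonempty
convex set, then so is some linear function dominated by `q`. -/
theorem exists_linearMap_le_of_convex (hq : IsSublinear q) {K : Set E} (hK : K.Nonempty)
    (hconv : ∀ v ∈ K, ∀ w ∈ K, ∀ y : R, 0 ≤ y → y ≤ 1 → y • v + (1 - y) • w ∈ K) {e : R}
    (he : ∀ w ∈ K, e ≤ q w) :
    ∃ μ : E →ₗ[R] R, (∀ x, μ x ≤ q x) ∧ ∀ w ∈ K, e ≤ μ w := by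
  obtain ⟨p, hp, hpq, h⟩ := hq.exists_le_of_cone
    -- The cone generated by `K × {e}`: the decreased `p` has `p (-w) ≤ -e`, so any linear map below
    -- `p` is at least `e` on `K`.
    (G := {v | ∃ t : R, 0 ≤ t ∧ ∃ w ∈ K, v = (t • w, t * e)})
    (by
      obtain ⟨w, hw⟩ := hK
      exact ⟨0, le_rfl, w, hw, by simp⟩)
    (by
      rintro _ ⟨s, hs, v, hv, rfl⟩ _ ⟨t, ht, w, hw, rfl⟩
      -- With `(s + t) * y = s`, the sum `s • v + t • w` is `s + t` times a convex combination, even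
      -- if `s + t` is not invertible.
      obtain ⟨y, hy0, hy1, hy⟩ :=
        IsCompleteDivOrdered.exists_mul_eq hs (le_add_of_nonneg_right ht)
      refine ⟨s + t, add_nonneg hs ht, _, hconv v hv w hw y hy0 hy1, ?_⟩
      rw [smul_add, ← mul_smul, ← mul_smul, mul_sub, hy, mul_one, add_sub_cancel_left, add_mul]
      rfl)
    (by
      rintro a ha _ ⟨t, ht, w, hw, rfl⟩
      exact ⟨a * t, mul_nonneg ha ht, w, hw, by simp [mul_smul, mul_assoc]⟩)
    (by
      rintro _ ⟨t, ht, w, hw, rfl⟩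
      exact (mul_le_mul_of_nonneg_left (he w hw) ht).trans (hq.smul_eq ht w).ge)
  obtain ⟨μ, hμ⟩ := hp.exists_linearMap_le
  refine ⟨μ, fun x => (hμ x).trans (hpq x), fun w hw => ?_⟩
  have h1 := (hμ (-w)).trans (by simpa using h (w, e) ⟨1, zero_le_one, w, hw, by simp⟩)
  rw [map_neg] at h1
  exact neg_le_neg_iff.1 h1

end IsSublinear

end HahnBanach

end L0Convex

namespace L0Convex

/-! ### Continuity, pasting and the weak separation of level sets. -/

section LowerSemicontinuity

variable {Ω : Type*} [MeasurableSpace Ω] {P : Measure Ω}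

instance instIsCompleteDivOrderedL0 [IsFiniteMeasure P] : IsCompleteDivOrdered (L0 P) where
  exists_isGLB := exists_isGLB
  exists_mul_eq := exists_mul_eq_of_le

/-- A positive radius such that the points near `y` are greater than `r`, if `r < y`. -/
noncomputable def radius (y : EReal) (r : ℝ) : ℝ :=
  -- At `⊤` the neighbourhood is `[|r| + 1, ∞]`. Where `r < y` fails, only positivity of the radius
  -- matters.
  if y = ⊤ then 1 / (|r| + 1) else if r < y.toReal then (y.toReal - r) / 2 else 1

theorem radius_pos (y : EReal) (r : ℝ) : 0 < radius y r := by
  unfold radius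
  split_ifs with h h'
  · positivity
  · linarith
  · exact one_pos

theorem measurable_radius : Measurable fun p : EReal × ℝ => radius p.1 p.2 := by
  unfold radius
  have h1 : Measurable fun p : EReal × ℝ => p.1.toReal := measurable_fst.ereal_toReal
  refine Measurable.ite (measurable_fst (measurableSet_singleton ⊤)) (by fun_prop)
    (Measurable.ite (measurableSet_lt measurable_snd h1) (by fun_prop) measurable_const)

theorem lt_of_near_radius {y z : EReal} {r : ℝ} (hr : (r : EReal) < y)
    (h : Near (radius y r) y z) : (r : EReal) < z := by
  induction y with
  | bot => exact absurd hr not_lt_bot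
  | top =>
    refine lt_of_lt_of_le ?_ (h.1 rfl)
    rw [radius, if_pos rfl, one_div_one_div, EReal.coe_lt_coe_iff]
    linarith [le_abs_self r]
  | coe y =>
    have hr' : r < y := EReal.coe_lt_coe_iff.1 hr
    refine lt_of_lt_of_le ?_ (h.2.2 y rfl).1
    rw [radius, if_neg (EReal.coe_ne_top y), EReal.toReal_coe, if_pos hr', EReal.coe_lt_coe_iff]
    linarith

/-- Strict dominance of a given random variable on a given event is an open condition. -/
theorem isOpen_setOf_lt_on (Y₀ : L0 P) (B : Set Ω) :
    IsOpen[L0barTopology P] {Z : L0bar P | ∀ᵐ ω ∂P, ω ∈ B → (Y₀ ω : EReal) < Z ω} := by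
  intro Y hY
  have hm : AEMeasurable (fun ω => radius (Y ω) (Y₀ ω)) P :=
    (measurable_radius.comp (Y.measurable.prodMk Y₀.measurable)).aemeasurable
  have hε := AEEqFun.coeFn_mk _ hm.aestronglyMeasurable
  refine ⟨AEEqFun.mk _ hm.aestronglyMeasurable, ?_, fun Z hZ => ?_⟩
  · filter_upwards [hε] with ω h
    rw [h]
    exact radius_pos _ _
  · change ∀ᵐ ω ∂P, ω ∈ B → (Y₀ ω : EReal) < Z ω
    filter_upwards [hε, hZ, hY] with ω h hZ hY hB
    rw [h] at hZ
    exact lt_of_near_radius (hY hB) hZ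

theorem le_toBar_iff {Z : L0bar P} {Y₀ : L0 P} :
    Z ≤ toBar Y₀ ↔ ∀ᵐ ω ∂P, Z ω ≤ (Y₀ ω : EReal) := by
  rw [← AEEqFun.coeFn_le]
  have h := AEEqFun.coeFn_comp Real.toEReal continuous_coe_real_ereal Y₀
  constructor <;> intro h'
  · filter_upwards [h, h'] with ω h h'
    exact h'.trans_eq h
  · filter_upwards [h, h'] with ω h h'
    exact h'.trans_eq h.symm

theorem coeFn_ind {A : Set Ω} (hA : MeasurableSet A) :
    ind P A hA =ᵐ[P] A.indicator fun _ => (1 : ℝ) :=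
  AEEqFun.coeFn_mk _ _

theorem ind_nonneg {A : Set Ω} (hA : MeasurableSet A) : 0 ≤ ind P A hA := by
  rw [← AEEqFun.coeFn_le]
  filter_upwards [coeFn_ind (P := P) hA, AEEqFun.coeFn_zero (α := Ω) (β := ℝ) (μ := P)] with ω h h0
  rw [h, h0]
  exact Set.indicator_nonneg (fun _ _ => zero_le_one) ω

theorem ind_le_one {A : Set Ω} (hA : MeasurableSet A) : ind P A hA ≤ 1 := by
  rw [← AEEqFun.coeFn_le]
  filter_upwards [coeFn_ind (P := P) hA, AEEqFun.coeFn_one (α := Ω) (β := ℝ) (μ := P)] with ω h h1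
  rw [h, h1]
  exact Set.indicator_le_self' (fun _ _ => zero_le_one) ω

variable {E : Type*} [AddCommGroup E] [Module (L0 P) E]

namespace IsL0Norm

variable {N : E → L0 P}

theorem neg (hN : IsL0Norm N) (x : E) : N (-x) = N x := by
  have := hN.smul (-1) x
  rwa [neg_one_smul, abs_neg, abs_of_nonneg zero_le_one, one_mul] at this

theorem isSublinear (hN : IsL0Norm N) : IsSublinear N :=
  ⟨hN.add_le, fun a x ha => by rw [hN.smul, abs_of_nonneg ha]⟩

/-- A linear function which is dominated by the norm is continuous. -/
theorem continuous_of_le (hN : IsL0Norm N) {μ : E →ₗ[L0 P] L0 P} (hμ : ∀ x, μ x ≤ N x) :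
    Continuous[normTopology N, L0topology P] μ := by
  have habs : ∀ x, |μ x| ≤ N x := fun x =>
    abs_le'.2 ⟨hμ x, by simpa only [map_neg, hN.neg] using hμ (-x)⟩
  refine @Continuous.mk _ _ (normTopology N) (L0topology P) _ fun U hU X hX => ?_
  obtain ⟨Q, -, hQ, ε, hε, h⟩ := hU (μ X) hX
  refine ⟨{N}, Set.finite_singleton N, subset_rfl, ε, hε, fun Z hZ => h (μ Z) fun q hq => ?_⟩
  rw [hQ hq, ← map_sub]
  exact (habs _).trans (hZ N rfl)

end IsL0Norm

namespace IsL0Convex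

variable {f : E → L0bar P}

/-- Level sets are `L⁰`-convex. -/
theorem convex_level (hf : IsL0Convex f) {Y₀ : L0 P} {X₁ X₂ : E} (h₁ : f X₁ ≤ toBar Y₀)
    (h₂ : f X₂ ≤ toBar Y₀) {Y : L0 P} (hY0 : 0 ≤ Y) (hY1 : Y ≤ 1) :
    f (Y • X₁ + (1 - Y) • X₂) ≤ toBar Y₀ := by
  rw [le_toBar_iff] at h₁ h₂ ⊢
  filter_upwards [h₁, h₂, hf X₁ X₂ Y hY0 hY1, AEEqFun.coeFn_le.2 hY0, AEEqFun.coeFn_le.2 hY1,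
    AEEqFun.coeFn_zero (α := Ω) (β := ℝ) (μ := P),
    AEEqFun.coeFn_one (α := Ω) (β := ℝ) (μ := P)] with ω h₁ h₂ h hY0 hY1 h0 h1
  rw [h0] at hY0
  rw [h1] at hY1
  have hY0' : (0 : ℝ) ≤ Y ω := hY0
  have hY1' : (0 : ℝ) ≤ 1 - Y ω := sub_nonneg.2 hY1
  refine h.trans ((add_le_add (mul_le_mul_of_nonneg_left h₁ (EReal.coe_nonneg.2 hY0'))
    (mul_le_mul_of_nonneg_left h₂ (EReal.coe_nonneg.2 hY1'))).trans_eq ?_)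
  norm_cast
  ring

/-- Pasting along an event `A` does not increase the values of an `L⁰`-convex function on `A`. -/
theorem paste_le (hf : IsL0Convex f) {A : Set Ω} (hA : MeasurableSet A) (X₁ X₂ : E) :
    ∀ᵐ ω ∂P, ω ∈ A → f (ind P A hA • X₁ + (1 - ind P A hA) • X₂) ω ≤ f X₁ ω := by
  filter_upwards [hf X₁ X₂ _ (ind_nonneg hA) (ind_le_one hA), coeFn_ind (P := P) hA]
    with ω h hi hω
  rw [hi, Set.indicator_of_mem hω] at h
  -- On `A` the weights are 1 and 0, and `0 * f X₂` vanishes even where `f X₂ = ⊤`.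
  simpa using h

/-- If `f > Y₀` on `B` throughout the ball of radius `ε` about `X₀`, then the level set
`{f ≤ Y₀}` has distance at least `ε` from `X₀` on `B`. -/
theorem lt_norm_of_level (hf : IsL0Convex f) {N : E → L0 P} (hN : IsL0Norm N) {Y₀ ε : L0 P}
    (hε : ε ∈ L0pp P) {B : Set Ω} (hB : MeasurableSet B) {X₀ : E}
    (hball : ∀ Z, N (Z - X₀) ≤ ε → ∀ᵐ ω ∂P, ω ∈ B → (Y₀ ω : EReal) < f Z ω) {Z : E}
    (hZ : f Z ≤ toBar Y₀) : ∀ᵐ ω ∂P, ω ∈ B → ε ω < N (Z - X₀) ω := by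
  set A : Set Ω := B ∩ {ω | N (Z - X₀) ω ≤ ε ω}
  have hA : MeasurableSet A :=
    hB.inter (measurableSet_le (N (Z - X₀)).measurable ε.measurable)
  -- Taking `Z` on `A` and `X₀` elsewhere stays in the ball, so `f > Y₀` on `B`; yet on `A` its
  -- value is at most `f Z ≤ Y₀`. Hence `A` is null.
  have hnorm : N (ind P A hA • Z + (1 - ind P A hA) • X₀ - X₀) ≤ ε := by
    have : ind P A hA • Z + (1 - ind P A hA) • X₀ - X₀ = ind P A hA • (Z - X₀) := by
      rw [smul_sub, sub_smul, one_smul]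
      abel
    rw [this, hN.smul, abs_of_nonneg (ind_nonneg hA), ← AEEqFun.coeFn_le]
    filter_upwards [coeFn_ind (P := P) hA, AEEqFun.coeFn_mul (ind P A hA) (N (Z - X₀)), hε]
      with ω hi hm hε
    rw [hm, Pi.mul_apply, hi]
    by_cases hω : ω ∈ A
    · rw [Set.indicator_of_mem hω, one_mul]
      exact hω.2
    · rw [Set.indicator_of_notMem hω, zero_mul]
      exact hε.le
  filter_upwards [hball _ hnorm, hf.paste_le hA Z X₀, le_toBar_iff.1 hZ] with ω h1 h2 h3 hω
  by_contra hlt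
  exact absurd ((h1 hω).trans_le ((h2 ⟨hω, not_lt.1 hlt⟩).trans h3)) (lt_irrefl _)

end IsL0Convex

/-- Continuous `L⁰`-convex functions are weakly lower semicontinuous. -/
theorem isLowerSemicont_weak [IsFiniteMeasure P] {N : E → L0 P} (hN : IsL0Norm N)
    {f : E → L0bar P} (hf : IsL0Convex f)
    (hcont : Continuous[normTopology N, L0barTopology P] f) :
    IsLowerSemicont (weakTopology N) f := by
  refine fun Y₀ => @IsClosed.mk _ (weakTopology N) _ fun X₀ hX₀ => ?_
  rcases Set.eq_empty_or_nonempty {X | f X ≤ toBar Y₀} with hC | hC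
  · exact ⟨∅, Set.finite_empty, Set.empty_subset _, 1, one_mem_L0pp, fun Z _ => by
      rw [hC, Set.compl_empty]; trivial⟩
  set B : Set Ω := {ω | (Y₀ ω : EReal) < f X₀ ω}
  have hB : MeasurableSet B :=
    measurableSet_lt (measurable_coe_real_ereal.comp Y₀.measurable) (f X₀).measurable
  obtain ⟨Q, -, hQ, ε, hε, hball⟩ := (@Continuous.isOpen_preimage _ _ (normTopology N)
    (L0barTopology P) _ hcont _ (isOpen_setOf_lt_on Y₀ B)) X₀
    (show ∀ᵐ ω ∂P, ω ∈ B → (Y₀ ω : EReal) < f X₀ ω from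
      Filter.Eventually.of_forall fun ω hω => hω)
  have hdist : ∀ Z, f Z ≤ toBar Y₀ → ∀ᵐ ω ∂P, ω ∈ B → ε ω < N (Z - X₀) ω := fun Z hZ =>
    hf.lt_norm_of_level hN hε hB (fun W hW => hball W fun q hq => by rwa [hQ hq]) hZ
  obtain ⟨μ, hμN, hμ⟩ := hN.isSublinear.exists_linearMap_le_of_convex
    (K := (fun Z => X₀ - Z) '' {X | f X ≤ toBar Y₀}) (hC.image _)
    (by
      rintro _ ⟨v, hv, rfl⟩ _ ⟨w, hw, rfl⟩ y hy0 hy1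
      refine ⟨_, hf.convex_level hv hw hy0 hy1, ?_⟩
      simp only [smul_sub, sub_smul, one_smul]
      abel)
    -- Off `B` nothing is known beyond `N ≥ 0`, hence the indicator.
    (e := ind P B hB * ε)
    (by
      rintro _ ⟨Z, hZ, rfl⟩
      rw [← hN.neg, neg_sub, ← AEEqFun.coeFn_le]
      filter_upwards [hdist Z hZ, AEEqFun.coeFn_mul (ind P B hB) ε, coeFn_ind (P := P) hB,
        AEEqFun.coeFn_le.2 (hN.nonneg (Z - X₀)),
        AEEqFun.coeFn_zero (α := Ω) (β := ℝ) (μ := P)] with ω h hm hi hn h0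
      rw [hm, Pi.mul_apply, hi]
      by_cases hω : ω ∈ B
      · rw [Set.indicator_of_mem hω, one_mul]
        exact (h hω).le
      · rw [Set.indicator_of_notMem hω, zero_mul]
        exact h0.symm.trans_le hn)
  have hδ : ∀ᵐ ω ∂P, ((2⁻¹ : ℝ) • ε) ω = 2⁻¹ * ε ω := AEEqFun.coeFn_smul _ _
  -- The factor one half makes `1_B ε ≤ ε / 2` impossible at any point of `B`; thus `B` would be
  -- null and `X₀` in the level set.
  refine ⟨{fun X => |μ X|}, Set.finite_singleton _, ?_, (2⁻¹ : ℝ) • ε, ?_, fun Z hZ hZC => hX₀ ?_⟩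
  · rintro _ rfl
    exact ⟨μ, hN.continuous_of_le hμN, rfl⟩
  · change ∀ᵐ ω ∂P, 0 < ((2⁻¹ : ℝ) • ε) ω
    filter_upwards [hδ, hε] with ω h hε
    rw [h]
    positivity
  · have h1 : ind P B hB * ε ≤ (2⁻¹ : ℝ) • ε := by
      refine (hμ _ ⟨Z, hZC, rfl⟩).trans (le_trans ?_ (hZ _ rfl))
      change μ (X₀ - Z) ≤ |μ (Z - X₀)|
      rw [← neg_sub Z X₀, map_neg]
      exact neg_le_abs _
    refine le_toBar_iff.2 ?_
    filter_upwards [AEEqFun.coeFn_le.2 h1, AEEqFun.coeFn_mul (ind P B hB) ε,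
      coeFn_ind (P := P) hB, hδ, hε] with ω h hm hi hδ hε
    by_contra hlt
    rw [hm, Pi.mul_apply, hi, Set.indicator_of_mem (show ω ∈ B from not_le.1 hlt), hδ] at h
    linarith

end LowerSemicontinuity

end L0Convex

theorem mainTheorem6 {Ω : Type*} [MeasurableSpace Ω] (P : Measure Ω) [IsProbabilityMeasure P]
    {E : Type*} [AddCommGroup E] [Module (L0Convex.L0 P) E]
    (N : E → L0Convex.L0 P) (hN : L0Convex.IsL0Norm N)
    (hE : L0Convex.SumPreservesRelCCP P E)
    (f : E → L0Convex.L0bar P) (hproper : L0Convex.IsProper f) (hconv : L0Convex.IsL0Convex f)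
    (hcont : Continuous[L0Convex.normTopology N, L0Convex.L0barTopology P] f) :
    L0Convex.IsLowerSemicont (L0Convex.weakTopology N) f :=
  L0Convex.isLowerSemicont_weak hN hconv hcont
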